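/- For an integrable function $f:\mathbb R/2\pi\mathbb Z\to\mathbb C$ write $\hat f(n)=\frac1{2\pi}\int_{-\pi}^{\pi}f(\theta)e^{-in\theta}\,d\theta$ for $n\in\mathbb Z$, and say that $F$ majorizes $f$ if, for every $n\in\mathbb Z$, $\hat F(n)$ is real and $\hat F(n)\ge|\hat f(n)|$. Norms and $L^p$ spaces on the circle are taken with respect to $d\theta/2\pi$. Let $j$ be a positive integer. For each complex-valued function $g$ in $L^{2j}(\mathbb R/2\pi\mathbb Z)$ there is a function $G$ in $L^{2j}(\mathbb R/2\pi\mathbb Z)$ with the following properties: (1) $\hat G(n)$ is real and $\hat G(n)\ge 0$ for every $n\in\mathbb Z$; (2) $\hat G(n)=0$ for every $n\in\mathbb Z$ at which the $n$-th Fourier coefficient of $(g\overline g)^{j-1}g$ is $0$; (3) $\|G\|_{2j}=\|g\|_{2j}$; (4) $(G\overline G)^{j-1}G$ majorizes $(g\overline g)^{j-1}g$. -/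

import Mathlib

open MeasureTheory AddCircle
open scoped ENNReal ComplexOrder ComplexConjugate

/-- The period `2π` is positive; Mathlib's Fourier theory on `AddCircle` asks for this instance. -/
instance factTwoPiPos : Fact (0 < 2 * Real.pi) := ⟨Real.two_pi_pos⟩

/-- `F` majorizes `f`: every Fourier coefficient of `F` is real and at least the modulus of the
corresponding coefficient of `f`. The order on `ℂ` used here is the standard partial order, in which
`(r : ℂ) ≤ z` says that `z` is real and `r ≤ z`. The coefficients are taken with respect to
normalized Lebesgue measure `dθ / 2π` on the circle. -/
def Majorizes (F f : AddCircle (2 * Real.pi) → ℂ) : Prop :=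
  ∀ n : ℤ, (‖fourierCoeff f n‖ : ℂ) ≤ fourierCoeff F n

/-- The function `(g ḡ)^(j-1) g`, used for `j ≥ 1`. -/
noncomputable def conjPower (j : ℕ) (g : AddCircle (2 * Real.pi) → ℂ) :
    AddCircle (2 * Real.pi) → ℂ :=
  fun x => (g x * conj (g x)) ^ (j - 1) * g x

/-!
The function `G` is obtained, up to a dilation, by maximizing a concave functional. Write
`p = 2 * j`, `h = conjPower j g` and `a n = |ĥ n|`. Over trigonometric polynomials `P` with
coefficients `c n ≥ 0` that vanish wherever `ĥ n = 0`, consider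
`Φ P = p * ∑ a n * c n - ‖P‖_p ^ p`.

It is bounded above. Twisting the coefficients of `P` by the phases of `ĥ` gives a polynomial `P'`
with `∑ a n * c n = ∫ h * conj P'`, so that Young's inequality gives
`p * ∑ a n * c n ≤ (p - 1) * ‖g‖_p ^ p + ‖P'‖_p ^ p`; and `‖P'‖_p ≤ ‖P‖_p`, since `p` is even and
majorization of trigonometric polynomials is preserved by products and conjugation
(`TrigMajorizes.integral_norm_pow_le`, `sum_mul_norm_fourierCoeff_conjPower_le`).

A maximizing sequence is Cauchy in `L^p` by Clarkson's inequality, and its limit `G` inherits the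
first-order conditions (`exists_limit_of_near_maximizers`). Increasing the `n`-th coefficient shows
that the `n`-th coefficient of `conjPower j G` has real part at least `a n` wherever `ĥ n ≠ 0`
(`le_re_fourierCoeff_conjPower_of_forall_le`); dilating shows `‖G‖_p ≤ ‖g‖_p`. That the coefficients
of `conjPower j G` are real and nonnegative holds for polynomials with nonnegative coefficients and
passes to the limit, by continuity of these coefficients in `L^p`
(`continuous_fourierCoeff_conjPower`). No attainment of the maximum is needed, and the functional
`∑ a n * c n` is never extended to `L^p`.

Finally `G` is multiplied by a constant `≥ 1` to make the norms equal. This is possible unless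
`G = 0`, in which case `ĥ = 0`, and so `g = 0` almost everywhere
(`integral_norm_pow_eq_zero_of_fourierCoeff_conjPower_eq_zero`).
-/

open Filter Topology

/-! ### Young's and Clarkson's inequalities -/

theorem succ_mul_pow_mul_le {x y : ℝ} (hx : 0 ≤ x) (hy : 0 ≤ y) (n : ℕ) :
    (n + 1) * (x ^ n * y) ≤ n * x ^ (n + 1) + y ^ (n + 1) := by
  induction n with
  | zero => simp
  | succ n ih =>
    have h1 := mul_le_mul_of_nonneg_left ih hx
    have h2 : 0 ≤ (x ^ (n + 1) - y ^ (n + 1)) * (x - y) := by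
      rcases le_total x y with h | h
      · exact mul_nonneg_of_nonpos_of_nonpos
          (sub_nonpos.2 (pow_le_pow_left₀ hx h _)) (sub_nonpos.2 h)
      · exact mul_nonneg (sub_nonneg.2 (pow_le_pow_left₀ hy h _)) (sub_nonneg.2 h)
    push_cast
    have e : x * ((n + 1) * (x ^ n * y)) = (n + 1) * (x ^ (n + 1) * y) := by ring
    have e' : x * (n * x ^ (n + 1) + y ^ (n + 1)) = n * x ^ (n + 2) + x * y ^ (n + 1) := by ring
    rw [e, e'] at h1
    have e2 : (x ^ (n + 1) - y ^ (n + 1)) * (x - y)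
        = x ^ (n + 2) + y ^ (n + 2) - x ^ (n + 1) * y - x * y ^ (n + 1) := by ring
    rw [e2] at h2
    have e3 : ((n : ℝ) + 1 + 1) * (x ^ (n + 1) * y)
      = (n + 1) * (x ^ (n + 1) * y) + x ^ (n + 1) * y := by ring
    have e4 : ((n : ℝ) + 1) * x ^ (n + 1 + 1) = n * x ^ (n + 2) + x ^ (n + 2) := by ring
    rw [e3, e4]
    linarith

/-- Young's inequality for the conjugate exponents `p / (p - 1)` and `p`. Its sharp constants let it
replace Hölder's inequality throughout. -/
theorem mul_pow_pred_mul_le {x y : ℝ} (hx : 0 ≤ x) (hy : 0 ≤ y) {p : ℕ} (hp : 0 < p) :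
    p * (x ^ (p - 1) * y) ≤ (p - 1) * x ^ p + y ^ p := by
  obtain ⟨n, rfl⟩ : ∃ n, p = n + 1 := ⟨p - 1, by omega⟩
  simpa using succ_mul_pow_mul_le hx hy n

/-- The pointwise form of Clarkson's inequality for the even exponent `2 * j`: apply
`x ^ j + y ^ j ≤ (x + y) ^ j`, the parallelogram law, and convexity of `x ^ j`. -/
theorem clarkson_complex (a b : ℂ) {j : ℕ} (hj : 0 < j) :
    ‖(2⁻¹ : ℝ) • (a + b)‖ ^ (2 * j) + ‖(2⁻¹ : ℝ) • (a - b)‖ ^ (2 * j)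
      ≤ (‖a‖ ^ (2 * j) + ‖b‖ ^ (2 * j)) / 2 := by
  have par : ‖(2⁻¹ : ℝ) • (a + b)‖ ^ 2 + ‖(2⁻¹ : ℝ) • (a - b)‖ ^ 2 = (‖a‖ ^ 2 + ‖b‖ ^ 2) / 2 := by
    have := parallelogram_law_with_norm ℝ a b
    simp only [norm_smul, mul_pow]
    norm_num
    linarith
  simp only [pow_mul]
  refine (pow_add_pow_le (by positivity) (by positivity) hj.ne').trans ?_
  rw [par]
  have := (convexOn_pow j).2 (Set.mem_Ici.2 (sq_nonneg ‖a‖)) (Set.mem_Ici.2 (sq_nonneg ‖b‖))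
    (by norm_num : (0 : ℝ) ≤ 1 / 2) (by norm_num : (0 : ℝ) ≤ 1 / 2) (by norm_num)
  simp only [smul_eq_mul] at this
  rw [show (‖a‖ ^ 2 + ‖b‖ ^ 2) / 2 = 1 / 2 * ‖a‖ ^ 2 + 1 / 2 * ‖b‖ ^ 2 by ring]
  linarith

/-! ### A maximizing sequence in a uniformly convex space -/

/-- Let `Φ v = p * A v - ‖T v‖ ^ p` on a convex cone `K`, where `A` and `T` are linear and `A` need
not be continuous with respect to `T`. If Clarkson's inequality holds in the target, a maximizing
sequence for `Φ` has images converging to some `G`, at which the first-order conditions for a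
maximum survive: `p * A v ≤ ‖G + T v‖ ^ p - ‖G‖ ^ p` for `v ∈ K`, and, from dilations of the
sequence, `‖G‖ ^ p ≤ R`. -/
theorem exists_limit_of_near_maximizers {V E : Type*} [AddCommGroup V] [Module ℝ V]
    [NormedAddCommGroup E] [NormedSpace ℝ E] [CompleteSpace E] {p : ℕ} (hp : 1 < p)
    (clarkson : ∀ x y : E, ‖(2⁻¹ : ℝ) • (x + y)‖ ^ p + ‖(2⁻¹ : ℝ) • (x - y)‖ ^ p
      ≤ (‖x‖ ^ p + ‖y‖ ^ p) / 2)
    (K : Set V) (K_zero : 0 ∈ K) (K_add : ∀ u ∈ K, ∀ v ∈ K, u + v ∈ K)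
    (K_smul : ∀ t : ℝ, 0 ≤ t → ∀ v ∈ K, t • v ∈ K)
    (T : V →ₗ[ℝ] E) (A : V →ₗ[ℝ] ℝ) (R : ℝ)
    (hA : ∀ v ∈ K, p * A v ≤ (p - 1) * R + ‖T v‖ ^ p) :
    ∃ (u : ℕ → V) (G : E), (∀ k, u k ∈ K) ∧ Tendsto (fun k => T (u k)) atTop (𝓝 G) ∧
      (∀ v ∈ K, p * A v ≤ ‖G + T v‖ ^ p - ‖G‖ ^ p) ∧ ‖G‖ ^ p ≤ R := by
  set Φ : V → ℝ := fun v => p * A v - ‖T v‖ ^ p with hΦ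
  set M := sSup (Φ '' K) with hM
  have bdd : BddAbove (Φ '' K) := by
    refine ⟨(p - 1) * R, ?_⟩
    rintro _ ⟨v, hv, rfl⟩
    have := hA v hv
    simp only [hΦ]; linarith
  have le_M : ∀ v ∈ K, Φ v ≤ M := fun v hv => le_csSup bdd ⟨v, hv, rfl⟩
  have M_le : M ≤ (p - 1) * R := by
    refine csSup_le ⟨_, 0, K_zero, rfl⟩ ?_
    rintro _ ⟨v, hv, rfl⟩
    have := hA v hv
    simp only [hΦ]; linarith
  have ex : ∀ k : ℕ, ∃ v ∈ K, M - 1 / ((k : ℝ) + 1) < Φ v := fun k => by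
    obtain ⟨_, ⟨v, hv, rfl⟩, h⟩ := exists_lt_of_lt_csSup (s := Φ '' K) ⟨_, 0, K_zero, rfl⟩
      (sub_lt_self M (by positivity : (0 : ℝ) < 1 / ((k : ℝ) + 1)))
    exact ⟨v, hv, h⟩
  choose u huK hu using ex
  have key : ∀ N m n : ℕ, N ≤ m → N ≤ n →
      (‖T (u m) - T (u n)‖ / 2) ^ p ≤ 1 / ((N : ℝ) + 1) := fun N m n hm hn => by
    have h1 := le_M _ (K_smul 2⁻¹ (by norm_num) _ (K_add _ (huK m) _ (huK n)))
    have h2 := clarkson (T (u m)) (T (u n))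
    have h3 := hu m
    have h4 := hu n
    have h5 : 1 / ((m : ℝ) + 1) ≤ 1 / ((N : ℝ) + 1) := by gcongr
    have h6 : 1 / ((n : ℝ) + 1) ≤ 1 / ((N : ℝ) + 1) := by gcongr
    have e : ‖(2⁻¹ : ℝ) • (T (u m) - T (u n))‖ = ‖T (u m) - T (u n)‖ / 2 := by
      rw [norm_smul]; norm_num; ring
    rw [e] at h2
    simp only [hΦ, map_smul, map_add, smul_eq_mul] at h1 h3 h4
    linarith
  -- `Φ` at the midpoint of `u m` and `u n` is at most `M`, so Clarkson's inequality bounds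
  -- the distance of their images; this is `key`.
  have cau : CauchySeq fun k => T (u k) := by
    rw [Metric.cauchySeq_iff]
    intro ε hε
    obtain ⟨N, hN⟩ := exists_nat_one_div_lt (by positivity : 0 < (ε / 2) ^ p)
    refine ⟨N, fun m hm n hn => ?_⟩
    have := lt_of_pow_lt_pow_left₀ p (by positivity) ((key N m n hm hn).trans_lt hN)
    rw [dist_eq_norm]; linarith
  obtain ⟨G, hG⟩ := cauchySeq_tendsto_of_complete cau
  have limΦ : Tendsto (fun k => Φ (u k)) atTop (𝓝 M) := by
    refine tendsto_of_tendsto_of_tendsto_of_le_of_le (g := fun k : ℕ => M - 1 / ((k : ℝ) + 1)) ?_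
      tendsto_const_nhds (fun k => (hu k).le) (fun k => le_M _ (huK k))
    simpa using tendsto_const_nhds.sub (tendsto_one_div_add_atTop_nhds_zero_nat (𝕜 := ℝ))
  have limB : Tendsto (fun k => ‖T (u k)‖ ^ p) atTop (𝓝 (‖G‖ ^ p)) := hG.norm.pow p
  have limA : Tendsto (fun k => p * A (u k)) atTop (𝓝 (M + ‖G‖ ^ p)) := by
    refine (limΦ.add limB).congr fun k => ?_
    simp [hΦ]
  refine ⟨u, G, huK, hG, fun v hv => ?_, ?_⟩
  · have lim : Tendsto (fun k => p * A (u k) + p * A v - ‖T (u k) + T v‖ ^ p) atTop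
        (𝓝 (M + ‖G‖ ^ p + p * A v - ‖G + T v‖ ^ p)) :=
      (limA.add_const _).sub ((hG.add_const _).norm.pow p)
    have := le_of_tendsto lim (Eventually.of_forall fun k => ?_) (b := M)
    · linarith
    · have := le_M _ (K_add _ (huK k) _ hv)
      simp only [hΦ, map_add] at this
      linarith
  · -- Comparing with `s • u k` for `s < 1` and letting `s → 1` gives `p ‖G‖ ^ p ≤ M + ‖G‖ ^ p`.
    have scaled : ∀ s : ℝ, 0 ≤ s → s < 1 → p * s ^ (p - 1) * ‖G‖ ^ p ≤ M + ‖G‖ ^ p := by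
      intro s hs hs1
      have lim := (limA.const_mul s).sub (limB.const_mul (s ^ p))
      have h1 := le_of_tendsto lim (Eventually.of_forall fun k => ?_) (b := M)
      · have h2 := mul_pow_pred_mul_le hs zero_le_one (p := p) (by omega)
        have e : s ^ p = s ^ (p - 1) * s := by rw [← pow_succ]; congr 1; omega
        rw [one_pow, mul_one] at h2
        have h3 : p * s ^ (p - 1) * (1 - s) ≤ 1 - s ^ p := by
          rw [e] at h2 ⊢
          linarith
        have h4 := mul_le_mul_of_nonneg_right h3 (by positivity : 0 ≤ ‖G‖ ^ p)
        have h5 : 0 < 1 - s := by linarith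
        refine le_of_mul_le_mul_left ?_ h5
        linarith
      · have := le_M _ (K_smul s hs _ (huK k))
        simp only [hΦ, map_smul, norm_smul, smul_eq_mul, Real.norm_of_nonneg hs, mul_pow] at this
        linarith
    have lim : Tendsto (fun s : ℝ => p * s ^ (p - 1) * ‖G‖ ^ p) (𝓝[<] 1)
        (𝓝 (p * 1 ^ (p - 1) * ‖G‖ ^ p)) := by
      refine Tendsto.mono_left ?_ nhdsWithin_le_nhds
      exact Continuous.tendsto (by fun_prop) 1
    have h1 := le_of_tendsto lim (b := M + ‖G‖ ^ p) (by
      filter_upwards [Ioo_mem_nhdsLT (show (0 : ℝ) < 1 by norm_num)] with s hs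
      exact scaled s hs.1.le hs.2)
    have h2 : (0 : ℝ) < p - 1 := by
      have : (1 : ℝ) < p := by exact_mod_cast hp
      linarith
    refine le_of_mul_le_mul_left ?_ h2
    rw [one_pow, mul_one] at h1
    linarith

/-! ### Norms in `L^p` for natural `p` -/

section Lp

variable {α : Type*} [MeasurableSpace α] {μ : Measure α}

theorem toReal_eLpNorm_pow {f : α → ℂ} {p : ℕ} (hp : p ≠ 0) (hf : MemLp f (p : ℝ≥0∞) μ) :
    (eLpNorm f p μ).toReal ^ p = ∫ x, ‖f x‖ ^ p ∂μ := by
  have h0 : 0 ≤ ∫ x, ‖f x‖ ^ p ∂μ := integral_nonneg fun x => by positivity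
  rw [hf.eLpNorm_eq_integral_rpow_norm (by exact_mod_cast hp) (ENNReal.natCast_ne_top p)]
  simp only [ENNReal.toReal_natCast, Real.rpow_natCast]
  rw [ENNReal.toReal_ofReal (by positivity), Real.rpow_inv_natCast_pow h0 hp]

theorem Lp_norm_pow {p : ℕ} (hp : p ≠ 0) (u : Lp ℂ (p : ℝ≥0∞) μ) :
    ‖u‖ ^ p = ∫ x, ‖u x‖ ^ p ∂μ := by
  rw [Lp.norm_def, toReal_eLpNorm_pow hp (Lp.memLp u)]

theorem Lp_clarkson {j : ℕ} (hj : 0 < j) (u v : Lp ℂ ((2 * j : ℕ) : ℝ≥0∞) μ) :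
    ‖(2⁻¹ : ℝ) • (u + v)‖ ^ (2 * j) + ‖(2⁻¹ : ℝ) • (u - v)‖ ^ (2 * j)
      ≤ (‖u‖ ^ (2 * j) + ‖v‖ ^ (2 * j)) / 2 := by
  have hp : 2 * j ≠ 0 := by omega
  have int : ∀ w : Lp ℂ ((2 * j : ℕ) : ℝ≥0∞) μ, Integrable (fun x => ‖w x‖ ^ (2 * j)) μ :=
    fun w => (Lp.memLp w).integrable_norm_pow hp
  simp only [Lp_norm_pow hp]
  rw [← integral_add (int _) (int _), ← integral_add (int _) (int _), ← integral_div]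
  refine integral_mono_ae ((int _).add (int _)) (((int _).add (int _)).div_const 2) ?_
  filter_upwards [Lp.coeFn_smul (2⁻¹ : ℝ) (u + v), Lp.coeFn_smul (2⁻¹ : ℝ) (u - v),
    Lp.coeFn_add u v, Lp.coeFn_sub u v] with x h1 h2 h3 h4
  simp only [h1, h2, Pi.smul_apply, h3, h4, Pi.add_apply, Pi.sub_apply]
  exact clarkson_complex (u x) (v x) hj

end Lp

/-! ### Continuity of Fourier coefficients of nonlinear expressions -/

section Continuity

/-- A weighted bound of `x * (1 + x + y) ^ (p - 1)` in which `y` carries a small constant: split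
according to whether `x ≤ δ * (1 + y)`. -/
theorem mul_pow_pred_le_of_pos {x y δ : ℝ} (hx : 0 ≤ x) (hy : 0 ≤ y) (hδ : 0 < δ) (hδ1 : δ ≤ 1)
    {p : ℕ} (hp : 0 < p) :
    x * (1 + x + y) ^ (p - 1) ≤ 2 ^ (p - 1) * (δ * (1 + y) ^ p + x ^ p / δ ^ p) := by
  have pow_eq : ∀ z : ℝ, z ^ p = z * z ^ (p - 1) := fun z => by
    rw [← pow_succ']; congr 1; omega
  rcases le_or_gt x (δ * (1 + y)) with h | h
  · have h1 : 1 + x + y ≤ 2 * (1 + y) := by nlinarith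
    calc x * (1 + x + y) ^ (p - 1) ≤ δ * (1 + y) * (2 * (1 + y)) ^ (p - 1) := by gcongr
      _ = 2 ^ (p - 1) * (δ * (1 + y) ^ p) := by rw [mul_pow, pow_eq (1 + y)]; ring
      _ ≤ _ := by
        gcongr
        exact le_add_of_nonneg_right (by positivity)
  · have h1 : x ≤ x / δ := le_div_self hx hδ hδ1
    have h2 : 1 + y ≤ x / δ := by rw [le_div_iff₀ hδ]; linarith
    have h3 : 1 + x + y ≤ 2 * (x / δ) := by linarith
    calc x * (1 + x + y) ^ (p - 1) ≤ (x / δ) * (2 * (x / δ)) ^ (p - 1) := by gcongr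
      _ = 2 ^ (p - 1) * (x ^ p / δ ^ p) := by rw [← div_pow, mul_pow, pow_eq (x / δ)]; ring
      _ ≤ _ := by
        gcongr
        exact le_add_of_nonneg_left (by positivity)

variable {α : Type*} [MeasurableSpace α] {μ : Measure α}

theorem integrable_comp_of_growth [IsFiniteMeasure μ] {p : ℕ} (hp : 0 < p) {Ψ : ℂ → ℂ}
    (hΨ : Continuous Ψ) {C : ℝ}
    (growth : ∀ a b, ‖Ψ a - Ψ b‖ ≤ C * (‖a - b‖ * (1 + ‖a - b‖ + ‖b‖) ^ (p - 1)))
    {f : α → ℂ} (hf : MemLp f (p : ℝ≥0∞) μ) : Integrable (fun x => Ψ (f x)) μ := by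
  have int : Integrable (fun x => ‖1 + ‖f x‖‖ ^ p) μ :=
    ((memLp_const (1 : ℝ)).add hf.norm).integrable_norm_pow hp.ne'
  refine (((int.const_mul |C|).add (integrable_const ‖Ψ 0‖))).mono'
    (hΨ.comp_aestronglyMeasurable hf.1) (ae_of_all _ fun x => ?_)
  have h1 := growth (f x) 0
  have h2 : ‖Ψ (f x)‖ ≤ ‖Ψ (f x) - Ψ 0‖ + ‖Ψ 0‖ := by
    simpa using norm_add_le (Ψ (f x) - Ψ 0) (Ψ 0)
  simp only [sub_zero, norm_zero, add_zero] at h1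
  simp only [Pi.add_apply]
  rw [Real.norm_of_nonneg (by positivity : 0 ≤ 1 + ‖f x‖)]
  have h3 : C * (‖f x‖ * (1 + ‖f x‖) ^ (p - 1)) ≤ |C| * (1 + ‖f x‖) ^ p := by
    have e : (1 + ‖f x‖) ^ p = (1 + ‖f x‖) * (1 + ‖f x‖) ^ (p - 1) := by
      rw [← pow_succ']; congr 1; omega
    rw [e]
    gcongr
    · exact le_abs_self C
    · linarith
  linarith

/-- If the increments of `Ψ` grow at most like those of a polynomial of degree `p`, then the Fourier
coefficients of `Ψ ∘ u` depend continuously on `u` in `L^p`. -/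
theorem continuous_fourierCoeff_comp {T : ℝ} [Fact (0 < T)] {p : ℕ} (hp : 0 < p)
    [Fact (1 ≤ (p : ℝ≥0∞))] {Ψ : ℂ → ℂ} (hΨ : Continuous Ψ) {C : ℝ} (hC : 0 ≤ C)
    (growth : ∀ a b, ‖Ψ a - Ψ b‖ ≤ C * (‖a - b‖ * (1 + ‖a - b‖ + ‖b‖) ^ (p - 1))) (n : ℤ) :
    Continuous fun u : Lp ℂ (p : ℝ≥0∞) (haarAddCircle (T := T)) =>
      fourierCoeff (fun x => Ψ (u x)) n := by
  have int : ∀ u : Lp ℂ (p : ℝ≥0∞) (haarAddCircle (T := T)),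
    Integrable (fun x => Ψ (u x)) haarAddCircle :=
    fun u => integrable_comp_of_growth hp hΨ growth (Lp.memLp u)
  rw [Metric.continuous_iff']
  intro u ε hε
  set D := ∫ x, (1 + ‖u x‖) ^ p ∂(haarAddCircle (T := T)) with hD
  have D_nonneg : 0 ≤ D := integral_nonneg fun x => by positivity
  have intD : Integrable (fun x => (1 + ‖u x‖) ^ p) (haarAddCircle (T := T)) := by
    refine (((memLp_const (1 : ℝ)).add (Lp.memLp u).norm).integrable_norm_pow hp.ne').congr
      (ae_of_all _ fun x => ?_)
    simp only [Pi.add_apply]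
    rw [Real.norm_of_nonneg (by positivity)]
  have bound : ∀ δ : ℝ, 0 < δ → δ ≤ 1 → ∀ v : Lp ℂ (p : ℝ≥0∞) (haarAddCircle (T := T)),
      dist (fourierCoeff (fun x => Ψ (v x)) n) (fourierCoeff (fun x => Ψ (u x)) n)
        ≤ C * 2 ^ (p - 1) * (δ * D + ‖v - u‖ ^ p / δ ^ p) := by
    intro δ hδ hδ1 v
    have intdiff : Integrable (fun x => ‖(v - u : Lp ℂ _ _) x‖ ^ p) (haarAddCircle (T := T)) :=
      (Lp.memLp _).integrable_norm_pow hp.ne'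
    rw [dist_eq_norm, fourierCoeff, fourierCoeff,
      ← integral_sub ((int v).fourier_smul _) ((int u).fourier_smul _), Lp_norm_pow hp.ne', hD,
      ← integral_const_mul, ← integral_div,
      ← integral_add (intD.const_mul δ) (intdiff.div_const _), ← integral_const_mul]
    refine norm_integral_le_of_norm_le
      (((intD.const_mul δ).add (intdiff.div_const _)).const_mul _) ?_
    filter_upwards [Lp.coeFn_sub v u] with x hx
    rw [← smul_sub, norm_smul, fourier_apply, Circle.norm_coe, one_mul, hx, Pi.sub_apply,
      mul_assoc]
    exact (growth _ _).trans (mul_le_mul_of_nonneg_left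
      (mul_pow_pred_le_of_pos (norm_nonneg _) (norm_nonneg _) hδ hδ1 hp) hC)
  set B := C * 2 ^ (p - 1) with hB
  have B_nonneg : 0 ≤ B := by positivity
  set δ := min 1 (ε / (2 * (B * D + 1))) with hδ
  have δ_pos : 0 < δ := by positivity
  have h1 : B * (δ * D) < ε := by
    have : δ ≤ ε / (2 * (B * D + 1)) := min_le_right _ _
    rw [le_div_iff₀ (by positivity)] at this
    nlinarith [mul_nonneg B_nonneg D_nonneg]
  have lim : Tendsto (fun v : Lp ℂ (p : ℝ≥0∞) (haarAddCircle (T := T)) =>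
      B * (δ * D + ‖v - u‖ ^ p / δ ^ p)) (𝓝 u) (𝓝 (B * (δ * D + ‖u - u‖ ^ p / δ ^ p))) :=
    Continuous.tendsto (by fun_prop) u
  have lt : B * (δ * D + ‖u - u‖ ^ p / δ ^ p) < ε := by simpa [hp.ne'] using h1
  filter_upwards [lim.eventually_lt_const lt] with v hv
  exact (bound δ δ_pos (min_le_left _ _) v).trans_lt hv

end Continuity

/-! ### The function `conjPower` -/

section ConjPower

variable {j : ℕ}

theorem norm_conjPower (hj : 0 < j) (g : AddCircle (2 * Real.pi) → ℂ)
    (x : AddCircle (2 * Real.pi)) : ‖conjPower j g x‖ = ‖g x‖ ^ (2 * j - 1) := by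
  obtain ⟨m, rfl⟩ : ∃ m, j = m + 1 := ⟨j - 1, by omega⟩
  rw [show 2 * (m + 1) - 1 = 2 * m + 1 by omega]
  simp only [conjPower, norm_mul, norm_pow, RCLike.norm_conj, add_tsub_cancel_right]
  ring

theorem conjPower_mul_conj (hj : 0 < j) (g : AddCircle (2 * Real.pi) → ℂ)
    (x : AddCircle (2 * Real.pi)) :
    conjPower j g x * conj (g x) = ((‖g x‖ ^ (2 * j) : ℝ) : ℂ) := by
  obtain ⟨m, rfl⟩ : ∃ m, j = m + 1 := ⟨j - 1, by omega⟩
  simp only [conjPower, add_tsub_cancel_right]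
  rw [mul_assoc, ← pow_succ, Complex.mul_conj, Complex.normSq_eq_norm_sq]
  push_cast
  ring

theorem conjPower_const_mul (c : ℝ) (g : AddCircle (2 * Real.pi) → ℂ) :
    conjPower j (fun x => c * g x)
      = fun x => ((c ^ (2 * (j - 1) + 1) : ℝ) : ℂ) * conjPower j g x := by
  funext x
  simp only [conjPower, map_mul, Complex.conj_ofReal]
  push_cast
  ring

theorem norm_mul_conj_pow_mul_sub_le (m : ℕ) {w : ℝ} {a b : ℂ} (ha : ‖a‖ ≤ w) (hb : ‖b‖ ≤ w) :
    ‖(a * conj a) ^ m * a - (b * conj b) ^ m * b‖ ≤ (2 * m + 1) * (w ^ (2 * m) * ‖a - b‖) := by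
  have hw : 0 ≤ w := (norm_nonneg a).trans ha
  induction m with
  | zero => simp
  | succ m ih =>
    have e : (a * conj a) ^ (m + 1) * a - (b * conj b) ^ (m + 1) * b
        = a * conj a * ((a * conj a) ^ m * a - (b * conj b) ^ m * b)
          + (a * conj (a - b) + (a - b) * conj b) * ((b * conj b) ^ m * b) := by
      simp only [map_sub]; ring
    rw [e]
    refine (norm_add_le _ _).trans ?_
    have h1 : ‖a * conj a * ((a * conj a) ^ m * a - (b * conj b) ^ m * b)‖
        ≤ w * w * ((2 * m + 1) * (w ^ (2 * m) * ‖a - b‖)) := by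
      rw [norm_mul, norm_mul, RCLike.norm_conj]
      gcongr
    have h2 : ‖(a * conj (a - b) + (a - b) * conj b) * ((b * conj b) ^ m * b)‖
        ≤ (w * ‖a - b‖ + ‖a - b‖ * w) * ((w * w) ^ m * w) := by
      rw [norm_mul, norm_mul, norm_pow, norm_mul, RCLike.norm_conj]
      gcongr
      refine (norm_add_le _ _).trans ?_
      rw [norm_mul, norm_mul, RCLike.norm_conj, RCLike.norm_conj]
      gcongr
    refine (add_le_add h1 h2).trans (le_of_eq ?_)
    push_cast
    ring

theorem conjPower_growth (hj : 0 < j) (a b : ℂ) :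
    ‖(a * conj a) ^ (j - 1) * a - (b * conj b) ^ (j - 1) * b‖
      ≤ 2 * j * (‖a - b‖ * (1 + ‖a - b‖ + ‖b‖) ^ (2 * j - 1)) := by
  have ha : ‖a‖ ≤ 1 + ‖a - b‖ + ‖b‖ := by
    have : ‖a‖ ≤ ‖a - b‖ + ‖b‖ := by simpa using norm_add_le (a - b) b
    linarith
  have hb : ‖b‖ ≤ 1 + ‖a - b‖ + ‖b‖ := by linarith [norm_nonneg (a - b)]
  have h1 : 1 ≤ 1 + ‖a - b‖ + ‖b‖ := by linarith [norm_nonneg (a - b), norm_nonneg b]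
  refine (norm_mul_conj_pow_mul_sub_le (j - 1) ha hb).trans ?_
  rw [mul_comm ‖a - b‖]
  gcongr
  · rw [Nat.cast_pred hj]; linarith
  · omega

/-- The identity satisfies the hypothesis of `continuous_fourierCoeff_comp` for every `p`. -/
theorem id_growth {p : ℕ} (a b : ℂ) :
    ‖a - b‖ ≤ 1 * (‖a - b‖ * (1 + ‖a - b‖ + ‖b‖) ^ (p - 1)) := by
  have h1 : 1 ≤ 1 + ‖a - b‖ + ‖b‖ := by linarith [norm_nonneg (a - b), norm_nonneg b]
  rw [one_mul]
  exact le_mul_of_one_le_right (norm_nonneg _) (one_le_pow₀ h1)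

theorem continuous_mul_conj_pow_mul (m : ℕ) : Continuous fun z : ℂ => (z * conj z) ^ m * z :=
  ((continuous_id.mul Complex.continuous_conj).pow m).mul continuous_id

theorem integrable_conjPower (hj : 0 < j) {g : AddCircle (2 * Real.pi) → ℂ}
    (hg : MemLp g ((2 * j : ℕ) : ℝ≥0∞) haarAddCircle) :
    Integrable (conjPower j g) haarAddCircle :=
  integrable_comp_of_growth (p := 2 * j) (by omega) (continuous_mul_conj_pow_mul (j - 1))
    (conjPower_growth hj) hg

theorem continuous_fourierCoeff_conjPower (hj : 0 < j) [Fact (1 ≤ ((2 * j : ℕ) : ℝ≥0∞))] (n : ℤ) :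
    Continuous fun u : Lp ℂ ((2 * j : ℕ) : ℝ≥0∞) (haarAddCircle (T := 2 * Real.pi)) =>
      fourierCoeff (conjPower j u) n :=
  continuous_fourierCoeff_comp (p := 2 * j) (by omega) (continuous_mul_conj_pow_mul (j - 1))
    (by positivity) (conjPower_growth hj) n

theorem continuous_fourierCoeff_Lp {T : ℝ} [Fact (0 < T)] {p : ℕ} (hp : 0 < p)
    [Fact (1 ≤ (p : ℝ≥0∞))] (n : ℤ) :
    Continuous fun u : Lp ℂ (p : ℝ≥0∞) (haarAddCircle (T := T)) => fourierCoeff u n :=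
  continuous_fourierCoeff_comp hp continuous_id zero_le_one id_growth n

end ConjPower

/-! ### Majorization of trigonometric polynomials -/

section TrigMajorizes

variable {T : ℝ}

theorem fourierCoeff_sum_mul_fourier [Fact (0 < T)] {ι : Type*} (s : Finset ι) (φ : ι → ℤ)
    (d : ι → ℂ) (n : ℤ) :
    fourierCoeff (fun x : AddCircle T => ∑ i ∈ s, d i * fourier (φ i) x) n
      = ∑ i ∈ s, d i * (Pi.single (φ i) 1 : ℤ → ℂ) n := by
  have e : (fun x : AddCircle T => ∑ i ∈ s, d i * fourier (φ i) x)
      = ∑ i ∈ s, fun x : AddCircle T => d i * fourier (φ i) x := by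
    funext x; rw [Finset.sum_apply]
  rw [e, fourierCoeff.sum, Finset.sum_apply]
  · refine Finset.sum_congr rfl fun i _ => ?_
    rw [fourierCoeff.const_mul, fourierCoeff_fourier]
  · intro i _
    exact (continuous_const.mul (map_continuous (fourier (φ i)))).integrable_of_hasCompactSupport
      (HasCompactSupport.of_compactSpace _)

/-- `F` and `f` are trigonometric polynomials given by sums over the same finite family of
exponentials, with the coefficients of `F` dominating those of `f` term by term. The frequencies
`φ i` may repeat, which makes closure under products immediate. -/
def TrigMajorizes (F f : AddCircle T → ℂ) : Prop :=
  ∃ (ι : Type) (s : Finset ι) (φ : ι → ℤ) (b : ι → ℂ) (c : ι → ℝ), (∀ i ∈ s, ‖b i‖ ≤ c i) ∧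
    f = (fun x => ∑ i ∈ s, b i * fourier (φ i) x) ∧
    F = fun x => ∑ i ∈ s, (c i : ℂ) * fourier (φ i) x

namespace TrigMajorizes

variable {F f F' f' : AddCircle T → ℂ}

theorem one : TrigMajorizes (fun _ : AddCircle T => (1 : ℂ)) fun _ => 1 :=
  ⟨Unit, {()}, fun _ => 0, fun _ => 1, fun _ => 1, by simp, by simp, by simp⟩

theorem mul (h : TrigMajorizes F f) (h' : TrigMajorizes F' f') :
    TrigMajorizes (fun x => F x * F' x) fun x => f x * f' x := by
  obtain ⟨ι, s, φ, b, c, hbc, rfl, rfl⟩ := h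
  obtain ⟨ι', s', φ', b', c', hbc', rfl, rfl⟩ := h'
  refine ⟨ι × ι', s ×ˢ s', fun i => φ i.1 + φ' i.2, fun i => b i.1 * b' i.2,
    fun i => c i.1 * c' i.2, fun i hi => ?_, ?_, ?_⟩
  · rw [Finset.mem_product] at hi
    rw [norm_mul]
    exact mul_le_mul (hbc _ hi.1) (hbc' _ hi.2) (norm_nonneg _)
      ((norm_nonneg _).trans (hbc _ hi.1))
  · funext x
    rw [Finset.sum_mul_sum, ← Finset.sum_product']
    refine Finset.sum_congr rfl fun i _ => ?_
    rw [fourier_add]; ring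
  · funext x
    rw [Finset.sum_mul_sum, ← Finset.sum_product']
    refine Finset.sum_congr rfl fun i _ => ?_
    rw [fourier_add]; push_cast; ring

theorem pow (h : TrigMajorizes F f) (m : ℕ) :
    TrigMajorizes (fun x => F x ^ m) fun x => f x ^ m := by
  induction m with
  | zero => simpa using one
  | succ m ih => simpa only [pow_succ] using ih.mul h

theorem conjugate (h : TrigMajorizes F f) :
    TrigMajorizes (fun x => conj (F x)) fun x => conj (f x) := by
  obtain ⟨ι, s, φ, b, c, hbc, rfl, rfl⟩ := h
  refine ⟨ι, s, fun i => -φ i, fun i => starRingEnd ℂ (b i), c, fun i hi => ?_, ?_, ?_⟩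
  · rw [RCLike.norm_conj]; exact hbc i hi
  · funext x; simp only [map_sum, map_mul, fourier_neg]
  · funext x; simp only [map_sum, map_mul, fourier_neg, Complex.conj_ofReal]

theorem norm_fourierCoeff_le [Fact (0 < T)] (h : TrigMajorizes F f) (n : ℤ) :
    (‖fourierCoeff f n‖ : ℂ) ≤ fourierCoeff F n := by
  obtain ⟨ι, s, φ, b, c, hbc, rfl, rfl⟩ := h
  rw [fourierCoeff_sum_mul_fourier, fourierCoeff_sum_mul_fourier]
  have e : ∀ i, (Pi.single (φ i) 1 : ℤ → ℂ) n = (((Pi.single (φ i) 1 : ℤ → ℝ) n : ℝ) : ℂ) := by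
    intro i
    by_cases hi : n = φ i <;> simp [hi]
  simp only [e]
  have nonneg : ∀ i, (0 : ℝ) ≤ (Pi.single (φ i) 1 : ℤ → ℝ) n := fun i => by
    by_cases hi : n = φ i <;> simp [hi]
  rw [show ∑ i ∈ s, (c i : ℂ) * (((Pi.single (φ i) 1 : ℤ → ℝ) n : ℝ) : ℂ)
    = ((∑ i ∈ s, c i * (Pi.single (φ i) 1 : ℤ → ℝ) n : ℝ) : ℂ) by push_cast; rfl,
    Complex.real_le_real]
  refine (norm_sum_le _ _).trans (Finset.sum_le_sum fun i hi => ?_)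
  rw [norm_mul, Complex.norm_real, Real.norm_of_nonneg (nonneg i)]
  exact mul_le_mul_of_nonneg_right (hbc i hi) (nonneg i)

end TrigMajorizes
end TrigMajorizes

/-! ### Pairings with `conjPower` -/

section Pairing

variable {j : ℕ} {g f : AddCircle (2 * Real.pi) → ℂ}

theorem norm_conjPower_mul_conj_le (hj : 0 < j) (x : AddCircle (2 * Real.pi)) :
    ((2 * j : ℕ) : ℝ) * ‖conjPower j g x * conj (f x)‖
      ≤ ((2 * j : ℕ) - 1) * ‖g x‖ ^ (2 * j) + ‖f x‖ ^ (2 * j) := by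
  rw [norm_mul, norm_conjPower hj, RCLike.norm_conj]
  exact mul_pow_pred_mul_le (norm_nonneg _) (norm_nonneg _) (by omega)

theorem integrable_conjPower_mul_conj (hj : 0 < j)
    (hg : MemLp g ((2 * j : ℕ) : ℝ≥0∞) haarAddCircle)
    (hf : MemLp f ((2 * j : ℕ) : ℝ≥0∞) haarAddCircle) :
    Integrable (fun x => conjPower j g x * conj (f x)) haarAddCircle := by
  have hp : 2 * j ≠ 0 := by omega
  have hp' : (1 : ℝ) ≤ (2 * j : ℕ) := by exact_mod_cast Nat.one_le_iff_ne_zero.2 hp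
  refine (((hg.integrable_norm_pow hp).const_mul (((2 * j : ℕ) : ℝ) - 1)).add
    (hf.integrable_norm_pow hp)).mono' ((integrable_conjPower hj hg).1.mul
      (Complex.continuous_conj.comp_aestronglyMeasurable hf.1)) (ae_of_all _ fun x => ?_)
  exact (le_mul_of_one_le_left (norm_nonneg _) hp').trans (norm_conjPower_mul_conj_le hj x)

/-- The integrated form of Young's inequality for the pairing of `conjPower j g` with `f`. It is an
equality for `f = g`, so it also expresses that `conjPower j g` is, up to the factor `2 * j`, a
subgradient of `∫ ‖·‖ ^ (2 * j)` at `g`. -/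
theorem norm_integral_conjPower_mul_conj_le (hj : 0 < j)
    (hg : MemLp g ((2 * j : ℕ) : ℝ≥0∞) haarAddCircle)
    (hf : MemLp f ((2 * j : ℕ) : ℝ≥0∞) haarAddCircle) :
    ((2 * j : ℕ) : ℝ) * ‖∫ x, conjPower j g x * conj (f x) ∂haarAddCircle‖
      ≤ ((2 * j : ℕ) - 1) * ∫ x, ‖g x‖ ^ (2 * j) ∂haarAddCircle
        + ∫ x, ‖f x‖ ^ (2 * j) ∂haarAddCircle := by
  have hp : 2 * j ≠ 0 := by omega
  have intg := (hg.integrable_norm_pow hp).const_mul (((2 * j : ℕ) : ℝ) - 1)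
  have intf := hf.integrable_norm_pow hp
  rw [← integral_const_mul, ← integral_add intg intf]
  refine (mul_le_mul_of_nonneg_left (norm_integral_le_integral_norm _) (Nat.cast_nonneg _)).trans ?_
  rw [← integral_const_mul]
  exact integral_mono ((integrable_conjPower_mul_conj hj hg hf).norm.const_mul _) (intg.add intf)
    fun x => norm_conjPower_mul_conj_le hj x

theorem integral_conjPower_mul_conj_self (hj : 0 < j) :
    ∫ x, conjPower j g x * conj (g x) ∂haarAddCircle
      = ((∫ x, ‖g x‖ ^ (2 * j) ∂haarAddCircle : ℝ) : ℂ) := by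
  simp only [conjPower_mul_conj hj]
  exact integral_ofReal

theorem integral_mul_conj_fourier (h : AddCircle (2 * Real.pi) → ℂ) (n : ℤ) :
    ∫ x, h x * conj (fourier n x : ℂ) ∂haarAddCircle = fourierCoeff h n := by
  rw [fourierCoeff]
  refine integral_congr_ae (ae_of_all _ fun x => ?_)
  simp only [fourier_neg, smul_eq_mul]
  ring

theorem TrigMajorizes.conjPower {F f : AddCircle (2 * Real.pi) → ℂ} (h : TrigMajorizes F f) :
    TrigMajorizes (conjPower j F) (conjPower j f) :=
  ((h.mul h.conjugate).pow (j - 1)).mul h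

/-- The majorant property of `L^(2j)` for trigonometric polynomials: `∫ ‖f‖ ^ (2 * j)` is the
zeroth Fourier coefficient of a product of copies of `f` and `conj f`. -/
theorem TrigMajorizes.integral_norm_pow_le (hj : 0 < j) {F f : AddCircle (2 * Real.pi) → ℂ}
    (h : TrigMajorizes F f) :
    ∫ x, ‖f x‖ ^ (2 * j) ∂haarAddCircle ≤ ∫ x, ‖F x‖ ^ (2 * j) ∂haarAddCircle := by
  have key := ((h.conjPower (j := j)).mul h.conjugate).norm_fourierCoeff_le 0
  rw [← integral_mul_conj_fourier, ← integral_mul_conj_fourier] at key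
  simp only [fourier_zero, map_one, mul_one] at key
  rw [integral_conjPower_mul_conj_self hj, integral_conjPower_mul_conj_self hj,
    Complex.real_le_real, Complex.norm_real] at key
  exact (le_abs_self _).trans key

theorem memLp_of_continuous {f : AddCircle (2 * Real.pi) → ℂ} (hf : Continuous f) (p : ℝ≥0∞) :
    MemLp f p haarAddCircle :=
  hf.memLp_of_hasCompactSupport (HasCompactSupport.of_compactSpace f)

/-- Twisting each coefficient `c n` by the phase of the `n`-th coefficient of `conjPower j g` turns
the left side into a pairing with `conjPower j g`; by the majorant property, the twisted polynomial
has `L^(2j)` norm at most that of the untwisted one. -/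
theorem sum_mul_norm_fourierCoeff_conjPower_le (hj : 0 < j)
    (hg : MemLp g ((2 * j : ℕ) : ℝ≥0∞) haarAddCircle) (s : Finset ℤ) (c : ℤ → ℝ)
    (hc : ∀ n, 0 ≤ c n) :
    ((2 * j : ℕ) : ℝ) * ∑ n ∈ s, c n * ‖fourierCoeff (conjPower j g) n‖
      ≤ ((2 * j : ℕ) - 1) * ∫ x, ‖g x‖ ^ (2 * j) ∂haarAddCircle
        + ∫ x : AddCircle (2 * Real.pi), ‖∑ n ∈ s, (c n : ℂ) * fourier n x‖ ^ (2 * j)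
          ∂haarAddCircle := by
  set a := fourierCoeff (conjPower j g) with ha
  -- The phase of `a n`; where `a n = 0`, division by zero gives `0`, which serves as well.
  set w : ℤ → ℂ := fun n => a n / ‖a n‖ with hw
  have norm_w : ∀ n, ‖w n‖ ≤ 1 := fun n => by
    simp only [hw, norm_div, Complex.norm_real, norm_norm]
    exact div_self_le_one _
  have w_mul : ∀ n, conj (w n) * a n = ‖a n‖ := fun n => by
    by_cases h0 : a n = 0
    · simp [h0]
    · have : (‖a n‖ : ℂ) ≠ 0 := by simpa using h0
      simp only [hw, map_div₀, Complex.conj_ofReal]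
      rw [div_mul_eq_mul_div, mul_comm, Complex.mul_conj, Complex.normSq_eq_norm_sq]
      push_cast
      field_simp
  set P : AddCircle (2 * Real.pi) → ℂ := fun x => ∑ n ∈ s, (c n * w n) * fourier n x with hP
  have maj : TrigMajorizes
      (fun x : AddCircle (2 * Real.pi) => ∑ n ∈ s, (c n : ℂ) * fourier n x) P := by
    refine ⟨ℤ, s, id, fun n => c n * w n, c, fun n _ => ?_, rfl, rfl⟩
    rw [norm_mul, Complex.norm_real, Real.norm_of_nonneg (hc n)]
    exact mul_le_of_le_one_right (hc n) (norm_w n)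
  have memP : MemLp P ((2 * j : ℕ) : ℝ≥0∞) haarAddCircle :=
    memLp_of_continuous (by simp only [hP]; fun_prop) _
  have pair : ∫ x, conjPower j g x * conj (P x) ∂haarAddCircle
      = ((∑ n ∈ s, c n * ‖a n‖ : ℝ) : ℂ) := by
    have e : ∀ x, conjPower j g x * conj (P x)
        = ∑ n ∈ s, (c n * conj (w n)) * (conjPower j g x * conj (fourier n x : ℂ)) := fun x => by
      simp only [hP, map_sum, map_mul, Complex.conj_ofReal, Finset.mul_sum]
      exact Finset.sum_congr rfl fun n _ => by ring
    simp only [e]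
    rw [integral_finsetSum]
    · push_cast
      refine Finset.sum_congr rfl fun n _ => ?_
      rw [integral_const_mul, integral_mul_conj_fourier, ← ha, mul_assoc, w_mul]
    · intro n _
      exact (integrable_conjPower_mul_conj hj hg
        (memLp_of_continuous (map_continuous (fourier n)) _)).const_mul _
  have h1 := norm_integral_conjPower_mul_conj_le hj hg memP
  rw [pair, Complex.norm_real] at h1
  have h2 := maj.integral_norm_pow_le hj
  have h3 := mul_le_mul_of_nonneg_left (le_abs_self (∑ n ∈ s, c n * ‖a n‖))
    (Nat.cast_nonneg (2 * j) : (0 : ℝ) ≤ _)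
  rw [Real.norm_eq_abs] at h1
  linarith

/-- Uniqueness of Fourier coefficients for `conjPower j g`: approximate `g` in `L^(2j)` by
trigonometric polynomials, all of which are orthogonal to `conjPower j g`. -/
theorem integral_norm_pow_eq_zero_of_fourierCoeff_conjPower_eq_zero (hj : 0 < j)
    (hg : MemLp g ((2 * j : ℕ) : ℝ≥0∞) haarAddCircle)
    (h0 : ∀ n, fourierCoeff (conjPower j g) n = 0) :
    ∫ x, ‖g x‖ ^ (2 * j) ∂haarAddCircle = 0 := by
  have hp : 2 * j ≠ 0 := by omega
  have : Fact (1 ≤ ((2 * j : ℕ) : ℝ≥0∞)) := ⟨by exact_mod_cast Nat.one_le_iff_ne_zero.2 hp⟩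
  set u : Lp ℂ ((2 * j : ℕ) : ℝ≥0∞) (haarAddCircle (T := 2 * Real.pi)) := hg.toLp g
  have hu : u =ᵐ[haarAddCircle] g := hg.coeFn_toLp
  have int : ∀ v : Lp ℂ ((2 * j : ℕ) : ℝ≥0∞) (haarAddCircle (T := 2 * Real.pi)),
      Integrable (fun x => conjPower j g x * conj (v x)) haarAddCircle :=
    fun v => integrable_conjPower_mul_conj hj hg (Lp.memLp v)
  -- The function `conjPower j g` is orthogonal to every trigonometric polynomial.
  have orth : ∀ v ∈ Submodule.span ℂ (Set.range (fourierLp (T := 2 * Real.pi)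
      ((2 * j : ℕ) : ℝ≥0∞))), ∫ x, conjPower j g x * conj (v x) ∂haarAddCircle = 0 := by
    intro v hv
    induction hv using Submodule.span_induction with
    | mem v hv =>
      obtain ⟨n, rfl⟩ := hv
      rw [← h0 n, ← integral_mul_conj_fourier]
      refine integral_congr_ae ?_
      filter_upwards [coeFn_fourierLp (T := 2 * Real.pi) ((2 * j : ℕ) : ℝ≥0∞) n] with x hx
      rw [hx]
    | zero =>
      refine (integral_congr_ae ?_).trans (integral_zero' _ _)
      filter_upwards [Lp.coeFn_zero ℂ ((2 * j : ℕ) : ℝ≥0∞) (haarAddCircle (T := 2 * Real.pi))]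
        with x hx
      rw [hx, Pi.zero_apply, map_zero, mul_zero]
    | add v w _ _ hv hw =>
      rw [← add_zero (0 : ℂ)]
      nth_rewrite 1 [← hv]
      rw [← hw, ← integral_add (int v) (int w)]
      refine integral_congr_ae ?_
      filter_upwards [Lp.coeFn_add v w] with x hx
      rw [hx, Pi.add_apply, map_add, mul_add]
    | smul t v _ hv =>
      rw [← mul_zero (conj t), ← hv, ← integral_const_mul]
      refine integral_congr_ae ?_
      filter_upwards [Lp.coeFn_smul t v] with x hx
      rw [hx, Pi.smul_apply, smul_eq_mul, map_mul]
      ring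
  have le : ∀ v ∈ Submodule.span ℂ (Set.range (fourierLp (T := 2 * Real.pi)
      ((2 * j : ℕ) : ℝ≥0∞))), ∫ x, ‖g x‖ ^ (2 * j) ∂haarAddCircle ≤ ‖u - v‖ ^ (2 * j) := by
    intro v hv
    have h1 := norm_integral_conjPower_mul_conj_le hj hg (Lp.memLp (u - v))
    have h2 : ∫ x, conjPower j g x * conj ((u - v : Lp ℂ _ _) x) ∂haarAddCircle
        = ((∫ x, ‖g x‖ ^ (2 * j) ∂haarAddCircle : ℝ) : ℂ) := by
      rw [← integral_conjPower_mul_conj_self hj, ← sub_zero (∫ x, _ * conj (g x) ∂_), ← orth v hv,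
        ← integral_sub (integrable_conjPower_mul_conj hj hg hg) (int v)]
      refine integral_congr_ae ?_
      filter_upwards [Lp.coeFn_sub u v, hu] with x hx hux
      rw [hx, Pi.sub_apply, hux, map_sub, mul_sub]
    rw [h2, Complex.norm_real, ← Lp_norm_pow hp, Real.norm_eq_abs] at h1
    have h3 := mul_le_mul_of_nonneg_left (le_abs_self (∫ x, ‖g x‖ ^ (2 * j) ∂haarAddCircle))
      (Nat.cast_nonneg (2 * j) : (0 : ℝ) ≤ _)
    linarith
  have closed : IsClosed {v : Lp ℂ ((2 * j : ℕ) : ℝ≥0∞) (haarAddCircle (T := 2 * Real.pi)) |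
      ∫ x, ‖g x‖ ^ (2 * j) ∂haarAddCircle ≤ ‖u - v‖ ^ (2 * j)} :=
    isClosed_le continuous_const (by fun_prop)
  have mem : u ∈ (Submodule.span ℂ (Set.range (fourierLp (T := 2 * Real.pi)
      ((2 * j : ℕ) : ℝ≥0∞)))).topologicalClosure := by
    rw [span_fourierLp_closure_eq_top (ENNReal.natCast_ne_top _)]
    trivial
  have h1 : ∫ x, ‖g x‖ ^ (2 * j) ∂haarAddCircle ≤ ‖u - u‖ ^ (2 * j) :=
    closure_minimal (show (_ : Set _) ⊆ _ from le) closed mem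
  rw [sub_self, norm_zero, zero_pow hp] at h1
  exact le_antisymm h1 (integral_nonneg fun x => by positivity)

end Pairing

/-! ### The extremal function -/

section Extremal

variable {j : ℕ}

theorem linearCombination_fourierLp_ae {T : ℝ} [Fact (0 < T)] {p : ℝ≥0∞} [Fact (1 ≤ p)]
    (c : ℤ →₀ ℝ) :
    Finsupp.linearCombination ℝ (fourierLp (T := T) p) c =ᵐ[haarAddCircle]
      fun x => ∑ n ∈ c.support, (c n : ℂ) * fourier n x := by
  rw [Finsupp.linearCombination_apply, Finsupp.sum]
  have h : ∀ᵐ x ∂(haarAddCircle (T := T)), ∀ n : ℤ,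
      (c n • fourierLp (T := T) p n : Lp ℂ p haarAddCircle) x = (c n : ℂ) * fourier n x := by
    rw [ae_all_iff]
    intro n
    filter_upwards [Lp.coeFn_smul (c n) (fourierLp (T := T) p n), coeFn_fourierLp (T := T) p n]
      with x h1 h2
    rw [h1, Pi.smul_apply, h2, Complex.real_smul]
  filter_upwards [h, Lp.coeFn_finsetSum c.support fun n => c n • fourierLp (T := T) p n]
    with x h1 h2
  rw [h2, Finset.sum_apply]
  exact Finset.sum_congr rfl fun n _ => h1 n

theorem conjPower_congr_ae {f g : AddCircle (2 * Real.pi) → ℂ} (h : f =ᵐ[haarAddCircle] g) :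
    conjPower j f =ᵐ[haarAddCircle] conjPower j g := by
  filter_upwards [h] with x hx
  simp only [conjPower, hx]

/-- The one-sided variational inequality in the direction of the `n`-th exponential bounds
the real part of the `n`-th Fourier coefficient of `conjPower j G` from below. The
subgradient inequality is used at the endpoint `G + t e_n`, and `t` then tends to `0`. -/
theorem le_re_fourierCoeff_conjPower_of_forall_le (hj : 0 < j)
    [Fact (1 ≤ ((2 * j : ℕ) : ℝ≥0∞))]
    (G : Lp ℂ ((2 * j : ℕ) : ℝ≥0∞) (haarAddCircle (T := 2 * Real.pi))) (n : ℤ) (a : ℝ)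
    (h : ∀ t : ℝ, 0 ≤ t → ((2 * j : ℕ) : ℝ) * (t * a)
      ≤ ‖G + t • fourierLp ((2 * j : ℕ) : ℝ≥0∞) n‖ ^ (2 * j) - ‖G‖ ^ (2 * j)) :
    a ≤ (fourierCoeff (conjPower j G) n).re := by
  have hp : 2 * j ≠ 0 := by omega
  set e := fourierLp (T := 2 * Real.pi) ((2 * j : ℕ) : ℝ≥0∞) n
  have le : ∀ t : ℝ, 0 < t → a ≤ (fourierCoeff (conjPower j (G + t • e : Lp ℂ _ _)) n).re := by
    intro t ht
    set u := G + t • e with hu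
    have h1 := norm_integral_conjPower_mul_conj_le hj (Lp.memLp u) (Lp.memLp G)
    have h2 : ((∫ x, ‖u x‖ ^ (2 * j) ∂haarAddCircle : ℝ) : ℂ)
        = ∫ x, conjPower j u x * conj (G x) ∂haarAddCircle
          + t * fourierCoeff (conjPower j u) n := by
      rw [← integral_conjPower_mul_conj_self hj, ← integral_mul_conj_fourier,
        ← integral_const_mul, ← integral_add
          (integrable_conjPower_mul_conj hj (Lp.memLp u) (Lp.memLp G))
          ((integrable_conjPower_mul_conj hj (Lp.memLp u)
            (memLp_of_continuous (map_continuous (fourier n)) _)).const_mul _)]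
      refine integral_congr_ae ?_
      filter_upwards [Lp.coeFn_add G (t • e), Lp.coeFn_smul t e,
        coeFn_fourierLp (T := 2 * Real.pi) ((2 * j : ℕ) : ℝ≥0∞) n] with x h1 h2 h3
      have : u x = G x + t * fourier n x := by
        rw [hu, h1, Pi.add_apply, h2, Pi.smul_apply, h3, Complex.real_smul]
      rw [show conj (u x) = conj (G x) + t * conj (fourier n x : ℂ) by
        rw [this, map_add, map_mul, Complex.conj_ofReal]]
      ring
    have h3 := congrArg Complex.re h2
    rw [Complex.add_re, Complex.re_ofReal_mul, Complex.ofReal_re] at h3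
    rw [← Lp_norm_pow hp] at h3
    rw [← Lp_norm_pow hp, ← Lp_norm_pow hp] at h1
    have h4 := h t ht.le
    have h5 := mul_le_mul_of_nonneg_left
      (Complex.re_le_norm (∫ x, conjPower j u x * conj (G x) ∂haarAddCircle))
      (Nat.cast_nonneg (2 * j) : (0 : ℝ) ≤ _)
    have h6 : (0 : ℝ) < (2 * j : ℕ) * t := by
      have : (0 : ℝ) < (2 * j : ℕ) := by exact_mod_cast Nat.pos_of_ne_zero hp
      positivity
    refine le_of_mul_le_mul_left ?_ h6
    have h7 := congrArg (((2 * j : ℕ) : ℝ) * ·) h3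
    simp only [mul_add] at h7
    linarith
  have lim : Tendsto (fun t : ℝ => (fourierCoeff (conjPower j (G + t • e : Lp ℂ _ _)) n).re)
      (𝓝[>] 0) (𝓝 (fourierCoeff (conjPower j (G + (0 : ℝ) • e : Lp ℂ _ _)) n).re) := by
    refine Tendsto.mono_left ?_ nhdsWithin_le_nhds
    have c1 : Continuous fun t : ℝ => G + t • e := by fun_prop
    exact (Complex.continuous_re.comp
      ((continuous_fourierCoeff_conjPower hj n).comp c1)).tendsto 0
  rw [zero_smul, add_zero] at lim
  exact ge_of_tendsto lim (eventually_mem_nhdsWithin.mono fun t ht => le t ht)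

/-- The theorem with `‖G‖ ≤ ‖g‖` in place of equality. The function `G` is the limit of a maximizing
sequence of trigonometric polynomials with nonnegative coefficients, supported where the
coefficients of `conjPower j g` do not vanish. -/
theorem exists_Lp_majorant (hj : 0 < j) [Fact (1 ≤ ((2 * j : ℕ) : ℝ≥0∞))]
    {g : AddCircle (2 * Real.pi) → ℂ} (hg : MemLp g ((2 * j : ℕ) : ℝ≥0∞) haarAddCircle) :
    ∃ G : Lp ℂ ((2 * j : ℕ) : ℝ≥0∞) (haarAddCircle (T := 2 * Real.pi)),
      (∀ n, 0 ≤ fourierCoeff G n) ∧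
      (∀ n, fourierCoeff (conjPower j g) n = 0 → fourierCoeff G n = 0) ∧
      Majorizes (conjPower j G) (conjPower j g) ∧
      ‖G‖ ^ (2 * j) ≤ ∫ x, ‖g x‖ ^ (2 * j) ∂haarAddCircle := by
  have hp : 2 * j ≠ 0 := by omega
  set a : ℤ → ℝ := fun n => ‖fourierCoeff (conjPower j g) n‖ with ha
  set e := fourierLp (T := 2 * Real.pi) ((2 * j : ℕ) : ℝ≥0∞) with he
  set K : Set (ℤ →₀ ℝ) :=
    {c | (∀ n, 0 ≤ c n) ∧ ∀ n, fourierCoeff (conjPower j g) n = 0 → c n = 0} with hK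
  obtain ⟨u, G, huK, lim, hmax, hR⟩ := exists_limit_of_near_maximizers (p := 2 * j) (by omega)
    (Lp_clarkson (μ := haarAddCircle (T := 2 * Real.pi)) hj) K ⟨by simp, by simp⟩
    (fun u hu v hv => ⟨fun n => add_nonneg (hu.1 n) (hv.1 n), fun n hn => by
      simp [hu.2 n hn, hv.2 n hn]⟩)
    (fun t ht v hv => ⟨fun n => mul_nonneg ht (hv.1 n), fun n hn => by simp [hv.2 n hn]⟩)
    (Finsupp.linearCombination ℝ e) (Finsupp.linearCombination ℝ a)
    (∫ x, ‖g x‖ ^ (2 * j) ∂haarAddCircle) (fun c hc => by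
      have h1 := sum_mul_norm_fourierCoeff_conjPower_le hj hg c.support c hc.1
      rw [Lp_norm_pow hp, Finsupp.linearCombination_apply, Finsupp.sum]
      refine h1.trans (add_le_add le_rfl (le_of_eq (integral_congr_ae ?_)))
      filter_upwards [linearCombination_fourierLp_ae (T := 2 * Real.pi)
        (p := ((2 * j : ℕ) : ℝ≥0∞)) c] with x hx
      rw [hx])
  have maj : ∀ c ∈ K, TrigMajorizes
      (fun x : AddCircle (2 * Real.pi) => ∑ n ∈ c.support, (c n : ℂ) * fourier n x)
      (fun x => ∑ n ∈ c.support, (c n : ℂ) * fourier n x) := fun c hc =>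
    ⟨ℤ, c.support, id, fun n => c n, c, fun n _ => by
      rw [Complex.norm_real, Real.norm_of_nonneg (hc.1 n)], rfl, rfl⟩
  have nonneg_of_maj : ∀ {F f : AddCircle (2 * Real.pi) → ℂ}, TrigMajorizes F f → ∀ n,
      0 ≤ fourierCoeff F n := fun h n =>
    le_trans (by exact_mod_cast norm_nonneg _) (h.norm_fourierCoeff_le n)
  have lim_coeff : ∀ n, Tendsto (fun k => fourierCoeff (Finsupp.linearCombination ℝ e (u k)) n)
      atTop (𝓝 (fourierCoeff G n)) := fun n =>
    ((continuous_fourierCoeff_Lp (Nat.pos_of_ne_zero hp) n).tendsto G).comp lim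
  have lim_conj : ∀ n, Tendsto
      (fun k => fourierCoeff (conjPower j (Finsupp.linearCombination ℝ e (u k))) n)
      atTop (𝓝 (fourierCoeff (conjPower j G) n)) := fun n =>
    ((continuous_fourierCoeff_conjPower hj n).tendsto G).comp lim
  have ae_eq := fun k => linearCombination_fourierLp_ae (T := 2 * Real.pi)
        (p := ((2 * j : ℕ) : ℝ≥0∞)) (u k)
  have conj_nonneg : ∀ n, 0 ≤ fourierCoeff (conjPower j G) n := fun n =>
    ge_of_tendsto' (lim_conj n) fun k => by
      rw [fourierCoeff_congr_ae (conjPower_congr_ae (ae_eq k))]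
      exact nonneg_of_maj (maj _ (huK k)).conjPower n
  refine ⟨G, fun n => ge_of_tendsto' (lim_coeff n) fun k => ?_, fun n hn => ?_, fun n => ?_, hR⟩
  · rw [fourierCoeff_congr_ae (ae_eq k)]
    exact nonneg_of_maj (maj _ (huK k)) n
  · refine tendsto_nhds_unique (lim_coeff n) (tendsto_const_nhds.congr fun k => ?_)
    rw [fourierCoeff_congr_ae (ae_eq k)]
    refine ((fourierCoeff_sum_mul_fourier _ id _ n).trans
      (Finset.sum_eq_zero fun m _ => ?_)).symm
    rcases eq_or_ne n m with rfl | hm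
    · simp [(huK k).2 n hn]
    · simp [hm]
  · rcases eq_or_ne (fourierCoeff (conjPower j g) n) 0 with hn | hn
    · simpa [hn] using conj_nonneg n
    · have key := le_re_fourierCoeff_conjPower_of_forall_le hj G n (a n) fun t ht => by
        have := hmax (Finsupp.single n t) ⟨fun m => by
          by_cases hm : n = m <;> simp [hm, ht], fun m hm => by
            rw [Finsupp.single_eq_of_ne]
            rintro rfl
            exact hn hm⟩
        simpa [Finsupp.linearCombination_single] using this
      exact Complex.le_def.2 ⟨key, (Complex.le_def.1 (conj_nonneg n)).2⟩

end Extremal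

/-! ### Normalization -/

theorem theorem4p1 (j : ℕ) (hj : 0 < j) (g : AddCircle (2 * Real.pi) → ℂ)
    (hg : MemLp g ((2 * j : ℕ) : ℝ≥0∞) haarAddCircle) :
    ∃ G : AddCircle (2 * Real.pi) → ℂ,
      MemLp G ((2 * j : ℕ) : ℝ≥0∞) haarAddCircle ∧
      (∀ n : ℤ, 0 ≤ fourierCoeff G n) ∧
      (∀ n : ℤ, fourierCoeff (conjPower j g) n = 0 → fourierCoeff G n = 0) ∧
      eLpNorm G ((2 * j : ℕ) : ℝ≥0∞) haarAddCircle =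
        eLpNorm g ((2 * j : ℕ) : ℝ≥0∞) haarAddCircle ∧
      Majorizes (conjPower j G) (conjPower j g) := by
  have hp : 2 * j ≠ 0 := by omega
  have : Fact (1 ≤ ((2 * j : ℕ) : ℝ≥0∞)) := ⟨by exact_mod_cast Nat.one_le_iff_ne_zero.2 hp⟩
  obtain ⟨G, G_nonneg, G_zero, G_maj, G_le⟩ := exists_Lp_majorant hj hg
  set γ := (eLpNorm g ((2 * j : ℕ) : ℝ≥0∞) haarAddCircle).toReal with hγ
  rw [← toReal_eLpNorm_pow hp hg] at G_le
  have le : ‖G‖ ≤ γ := le_of_pow_le_pow_left₀ hp ENNReal.toReal_nonneg G_le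
  -- When `G = 0`, all Fourier coefficients of `conjPower j g` vanish, whence `g = 0`.
  have scale : ∃ c : ℝ, 1 ≤ c ∧ c * ‖G‖ = γ := by
    rcases eq_or_ne G 0 with h0 | h0
    · refine ⟨1, le_rfl, ?_⟩
      have conj_zero : ∀ n, fourierCoeff (conjPower j G) n = 0 := fun n => by
        have hG : G =ᵐ[haarAddCircle] (0 : AddCircle (2 * Real.pi) → ℂ) := by
          rw [h0]; exact Lp.coeFn_zero _ _ _
        rw [fourierCoeff_congr_ae (conjPower_congr_ae hG)]
        simp [fourierCoeff, conjPower]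
      have h1 := integral_norm_pow_eq_zero_of_fourierCoeff_conjPower_eq_zero hj hg fun n => by
        have := G_maj n
        rw [conj_zero n] at this
        have h2 : ‖fourierCoeff (conjPower j g) n‖ ≤ 0 := by exact_mod_cast this
        exact norm_le_zero_iff.1 h2
      rw [← toReal_eLpNorm_pow hp hg] at h1
      rw [h0, norm_zero, mul_zero, hγ, eq_zero_of_pow_eq_zero h1]
    · have := norm_pos_iff.2 h0
      exact ⟨γ / ‖G‖, (one_le_div this).2 le, div_mul_cancel₀ _ this.ne'⟩
  obtain ⟨c, hc, hcG⟩ := scale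
  -- Dilating `G` by `c ≥ 1` only increases the nonnegative coefficients of `conjPower j G`.
  have c_nonneg : 0 ≤ c := zero_le_one.trans hc
  refine ⟨fun x => c * G x, (Lp.memLp G).const_mul (c : ℂ), fun n => ?_, fun n hn => ?_, ?_,
    fun n => ?_⟩
  · rw [fourierCoeff.const_mul]
    exact mul_nonneg (by exact_mod_cast c_nonneg) (G_nonneg n)
  · rw [fourierCoeff.const_mul, G_zero n hn, mul_zero]
  · rw [← ENNReal.toReal_eq_toReal_iff' ((Lp.memLp G).const_mul (c : ℂ)).eLpNorm_ne_top
      hg.eLpNorm_ne_top, ← hγ, ← hcG]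
    rw [show (fun x => (c : ℂ) * G x) = (c : ℂ) • (G : AddCircle (2 * Real.pi) → ℂ) from rfl,
      eLpNorm_const_smul, ENNReal.toReal_mul, Lp.norm_def]
    simp [abs_of_nonneg c_nonneg]
  · rw [conjPower_const_mul, fourierCoeff.const_mul]
    refine (G_maj n).trans ?_
    have h1 : (1 : ℂ) ≤ ((c ^ (2 * (j - 1) + 1) : ℝ) : ℂ) := by
      exact_mod_cast one_le_pow₀ hc
    exact le_mul_of_one_le_left (le_trans (by exact_mod_cast norm_nonneg _) (G_maj n)) h1
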